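/- Let $\Gamma$ be a (not necessarily commutative) monoid and let $A=\bigoplus_{\gamma\in\Gamma}A_\gamma$ be a $\Gamma$-graded (associative, unital) $\mathbf C$-algebra. For each $\gamma\in\Gamma$ let $\tau_\gamma$ be a graded algebra automorphism of $A$ (that is, $\tau_\gamma(A_\delta)=A_\delta$ for all $\delta\in\Gamma$), such that $\tau_{\gamma\gamma'}=\tau_\gamma\tau_{\gamma'}$ for all $\gamma,\gamma'\in\Gamma$. Let $A^\tau$ be the twisted algebra, i.e. the vector space $\bigoplus_{\gamma\in\Gamma}A_\gamma$ with the multiplication determined by \[ x*y:=x\,\tau_\gamma(y)\qquad\text{for all } x\in A_\gamma,\ y\in A . \] Let $h:\Gamma\to\mathbf N$ be a morphism of monoids (with $\mathbf N=\{0,1,2,\dots\}$ under addition), and consider $A$ and $A^\tau$ as $\mathbf N$-graded algebras with components $A_n=A^\tau_n=\bigoplus_{h(\gamma)=n}A_\gamma$. Assume that $A$ and $A^\tau$ are both generated, as $\mathbf C$-algebras, by $A_1=A_1^\tau$. Then $A^\tau$ is Koszul if and only if $A$ is Koszul. Here an $\mathbf N$-graded algebra $B=\bigoplus_{n\ge0}B_n$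 is called Koszul if $B_0$ is semisimple and the graded left $B$-module $B_0=B/\bigoplus_{n>0}B_n$, placed in degree $0$, admits a resolution \[ \cdots\to P^2\to P^1\to P^0\to B_0\to 0 \] by graded projective left $B$-modules, with maps of degree $0$, such that each $P^i$ is generated by its component of degree $i$. -/

import Mathlib

open scoped DirectSum

universe u v

noncomputable section

section Twist

variable {Γ : Type v} [AddMonoid Γ] {A : Type u} [Ring A] [Algebra ℂ A]

/-- For a family `𝒜 : Γ → Submodule ℂ A` (the homogeneous components of a `Γ`-graded algebra, the
monoid `Γ` being written additively but not assumed commutative): a family of graded algebra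
automorphisms `τ γ` of `A` that is multiplicative in `γ`. Multiplication in `A ≃ₐ[ℂ] A` is
composition. -/
structure TwistingFamily (𝒜 : Γ → Submodule ℂ A) where
  /-- The automorphism attached to an element of the monoid. -/
  aut : Γ → (A ≃ₐ[ℂ] A)
  /-- Each automorphism is graded, i.e. preserves every homogeneous component. -/
  map_mem : ∀ (γ δ : Γ) (x : A), x ∈ 𝒜 δ → aut γ x ∈ 𝒜 δ
  /-- Multiplicativity. -/
  map_add : ∀ γ δ : Γ, aut (γ + δ) = aut γ * aut δ

/-- The underlying vector space of the twisted algebra: it is that of `A`. -/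
def Twist {𝒜 : Γ → Submodule ℂ A} (_τ : TwistingFamily 𝒜) : Type u := A

namespace TwistingFamily

variable {𝒜 : Γ → Submodule ℂ A} (τ : TwistingFamily 𝒜)

theorem aut_zero : τ.aut 0 = 1 := by
  have h := τ.map_add 0 0
  rw [add_zero] at h
  exact (mul_eq_left.mp h.symm)

variable [DecidableEq Γ] [GradedAlgebra 𝒜]

/-- The bilinear map on `A` given by `(x, y) ↦ x * τ_γ(y)` for `x` of degree `γ`. -/
def mulMap : A →ₗ[ℂ] A →ₗ[ℂ] A :=
  DirectSum.toModule ℂ Γ (A →ₗ[ℂ] A)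
      (fun γ => (LinearMap.mul ℂ A).compl₂ (τ.aut γ).toLinearMap ∘ₗ (𝒜 γ).subtype) ∘ₗ
    (DirectSum.decomposeLinearEquiv 𝒜).toLinearMap

theorem mulMap_of_mem {γ : Γ} {x : A} (hx : x ∈ 𝒜 γ) (y : A) :
    τ.mulMap x y = x * τ.aut γ y := by
  lift x to 𝒜 γ using hx
  simp [mulMap]

theorem mulMap_mem {γ δ : Γ} {x y : A} (hx : x ∈ 𝒜 γ) (hy : y ∈ 𝒜 δ) :
    τ.mulMap x y ∈ 𝒜 (γ + δ) := by
  rw [τ.mulMap_of_mem hx]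
  exact SetLike.mul_mem_graded hx (τ.map_mem _ _ _ hy)

theorem mulMap_assoc (x y z : A) :
    τ.mulMap (τ.mulMap x y) z = τ.mulMap x (τ.mulMap y z) := by
  induction x using DirectSum.Decomposition.inductionOn 𝒜 with
  | zero => simp
  | add a b ha hb => simp only [_root_.map_add, LinearMap.add_apply, ha, hb]
  | homogeneous x =>
    induction y using DirectSum.Decomposition.inductionOn 𝒜 with
    | zero => simp
    | add a b ha hb => simp only [_root_.map_add, LinearMap.add_apply, ha, hb]
    | homogeneous y =>
      rw [τ.mulMap_of_mem (τ.mulMap_mem x.2 y.2), τ.mulMap_of_mem x.2, τ.mulMap_of_mem x.2,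
        τ.mulMap_of_mem y.2, map_mul, τ.map_add, AlgEquiv.mul_apply, mul_assoc]

theorem one_mulMap (x : A) : τ.mulMap 1 x = x := by
  rw [τ.mulMap_of_mem SetLike.GradedOne.one_mem, τ.aut_zero, one_mul, AlgEquiv.one_apply]

theorem mulMap_one (x : A) : τ.mulMap x 1 = x := by
  induction x using DirectSum.Decomposition.inductionOn 𝒜 with
  | zero => simp
  | add a b ha hb => simp only [_root_.map_add, LinearMap.add_apply, ha, hb]
  | homogeneous x => rw [τ.mulMap_of_mem x.2, map_one, mul_one]

end TwistingFamily

namespace Twist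

variable {𝒜 : Γ → Submodule ℂ A} (τ : TwistingFamily 𝒜)

instance : AddCommGroup (Twist τ) := inferInstanceAs (AddCommGroup A)

instance : Module ℂ (Twist τ) := inferInstanceAs (Module ℂ A)

/-- The identity map, from the algebra to its twist. -/
def of : A ≃ₗ[ℂ] Twist τ := LinearEquiv.refl ℂ A

/-- The homogeneous components of the twisted algebra: the same subspaces as those of `A`. -/
def grading (γ : Γ) : Submodule ℂ (Twist τ) := (𝒜 γ).map (of τ).toLinearMap

variable [DecidableEq Γ] [GradedAlgebra 𝒜]

/-- The twisted algebra: its product is `x * y = x τ_γ(y)` for `x` of degree `γ`. -/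
instance : Ring (Twist τ) where
  __ := (inferInstance : AddCommGroup (Twist τ))
  one := of τ 1
  mul x y := of τ (τ.mulMap ((of τ).symm x) ((of τ).symm y))
  mul_assoc x y z := τ.mulMap_assoc x y z
  one_mul x := τ.one_mulMap x
  mul_one x := τ.mulMap_one x
  zero_mul x := LinearMap.map_zero₂ τ.mulMap x
  mul_zero x := map_zero (τ.mulMap x)
  left_distrib x y z := map_add (τ.mulMap x) y z
  right_distrib x y z := LinearMap.map_add₂ τ.mulMap x y z

theorem of_mul_of {γ : Γ} {x : A} (hx : x ∈ 𝒜 γ) (y : A) :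
    of τ x * of τ y = of τ (x * τ.aut γ y) :=
  congrArg (of τ) (τ.mulMap_of_mem hx y)

instance : Algebra ℂ (Twist τ) :=
  Algebra.ofModule (fun r x y => LinearMap.map_smul₂ τ.mulMap r x y)
    (fun r x y => map_smul (τ.mulMap x) r y)

/-- The twisted algebra is again `Γ`-graded. -/
instance : GradedAlgebra (grading τ) where
  one_mem := ⟨1, SetLike.GradedOne.one_mem, rfl⟩
  mul_mem := by
    rintro γ δ _ _ ⟨x, hx, rfl⟩ ⟨y, hy, rfl⟩
    exact ⟨τ.mulMap x y, τ.mulMap_mem hx hy, rfl⟩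
  __ := DirectSum.Decomposition.ofLinearMap (grading τ)
    (DirectSum.toModule ℂ Γ (⨁ γ, grading τ γ)
        (fun γ => DirectSum.lof ℂ Γ (fun γ => grading τ γ) γ ∘ₗ
          ((of τ).submoduleMap (𝒜 γ)).toLinearMap) ∘ₗ
      (DirectSum.decomposeLinearEquiv 𝒜).toLinearMap ∘ₗ (of τ).symm.toLinearMap)
    (by
      ext x
      obtain ⟨x, rfl⟩ := (of τ).surjective x
      induction x using DirectSum.Decomposition.inductionOn 𝒜 with
      | zero => simp
      | add a b ha hb => simp only [map_add, ha, hb]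
      | homogeneous x =>
        simp only [LinearMap.comp_apply, LinearEquiv.coe_coe, LinearEquiv.symm_apply_apply,
          DirectSum.decomposeLinearEquiv_apply, DirectSum.decompose_coe, ← DirectSum.lof_eq_of ℂ,
          DirectSum.toModule_lof]
        exact DirectSum.coeLinearMap_lof (grading τ) _ _)
    (by
      ext γ ⟨_, x, hx, rfl⟩ : 2
      lift x to 𝒜 γ using hx
      simp
      rfl)

end Twist

end Twist

section Coarsen

variable {Γ : Type v} [AddMonoid Γ] {A : Type u} [Ring A] [Algebra ℂ A]

/-- The components `A_n = ⨁_{h(γ) = n} A_γ` obtained from a `Γ`-grading through `h : Γ → ℕ`. -/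
def coarsen (𝒜 : Γ → Submodule ℂ A) (h : Γ →+ ℕ) (n : ℕ) : Submodule ℂ A :=
  ⨆ γ : {γ : Γ // h γ = n}, 𝒜 γ

variable (𝒜 : Γ → Submodule ℂ A) (h : Γ →+ ℕ)

theorem le_coarsen (γ : Γ) : 𝒜 γ ≤ coarsen 𝒜 h (h γ) :=
  le_iSup (fun δ : {δ : Γ // h δ = h γ} => 𝒜 δ) ⟨γ, rfl⟩

variable [DecidableEq Γ] [GradedAlgebra 𝒜]

/-- The `ℕ`-graded algebra underlying a `Γ`-graded algebra. -/
instance : GradedAlgebra (coarsen 𝒜 h) where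
  one_mem := by
    have := le_coarsen 𝒜 h 0 (SetLike.GradedOne.one_mem (A := 𝒜))
    rwa [map_zero] at this
  mul_mem := by
    intro m n x y hx hy
    refine Submodule.iSup_induction _ (motive := fun x => x * y ∈ coarsen 𝒜 h (m + n)) hx
      ?_ (by simp) (fun a b ha hb => by rw [add_mul]; exact add_mem ha hb)
    rintro ⟨γ, rfl⟩ x hx
    refine Submodule.iSup_induction _ (motive := fun y => x * y ∈ coarsen 𝒜 h (h γ + n)) hy
      ?_ (by simp) (fun a b ha hb => by rw [mul_add]; exact add_mem ha hb)
    rintro ⟨δ, rfl⟩ y hy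
    rw [← map_add]
    exact le_coarsen 𝒜 h _ (SetLike.mul_mem_graded hx hy)
  __ := DirectSum.Decomposition.ofLinearMap (coarsen 𝒜 h)
    (DirectSum.toModule ℂ Γ (⨁ n, coarsen 𝒜 h n)
        (fun γ => DirectSum.lof ℂ ℕ (fun n => coarsen 𝒜 h n) (h γ) ∘ₗ
          Submodule.inclusion (le_coarsen 𝒜 h γ)) ∘ₗ
      (DirectSum.decomposeLinearEquiv 𝒜).toLinearMap)
    (by
      ext x
      induction x using DirectSum.Decomposition.inductionOn 𝒜 with
      | zero => simp
      | add a b ha hb => simp only [map_add, ha, hb]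
      | homogeneous x => simp)
    (by
      ext n ⟨x, hx⟩ : 2
      simp only [LinearMap.comp_apply, DirectSum.coeLinearMap_lof, LinearMap.id_apply]
      induction hx using Submodule.iSup_induction' with
      | zero => simp; exact (map_zero (DirectSum.lof ℂ ℕ (fun n => coarsen 𝒜 h n) n)).symm
      | add a b ha hb iha ihb =>
        simp only [map_add, iha, ihb]
        exact (map_add (DirectSum.lof ℂ ℕ (fun n => coarsen 𝒜 h n) n) ⟨a, ha⟩ ⟨b, hb⟩).symm
      | mem γ x hx =>
        obtain ⟨γ, rfl⟩ := γ
        lift x to 𝒜 γ using hx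
        simp
        rfl)

end Coarsen

section Koszul

variable {A : Type u} [Ring A] [Algebra ℂ A]

/-- A linear resolution over an `ℕ`-graded algebra `A`: an exact sequence
`⋯ ⟶ P 2 ⟶ P 1 ⟶ P 0 ⟶ A / A_{>0} ⟶ 0` of graded left `A`-modules and `A`-linear maps of degree
`0`, each `P i` being projective and generated by its component of degree `i`. The module
`A / A_{>0}`, i.e. `A_0`, sits in degree `0`. As `A` lives in degrees `≥ 0`, a module generated in
degree `i ≥ 0` has no components of negative degree, so gradings by `ℕ` suffice. -/
structure LinearResolution (𝒜 : ℕ → Submodule ℂ A) [GradedAlgebra 𝒜] where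
  /-- The terms of the resolution. -/
  P : ℕ → Type u
  [addCommGroup : ∀ i, AddCommGroup (P i)]
  [moduleComplex : ∀ i, Module ℂ (P i)]
  [module : ∀ i, Module A (P i)]
  [isScalarTower : ∀ i, IsScalarTower ℂ A (P i)]
  /-- `deg i j` is the component of degree `j` of `P i`. -/
  deg : ∀ i, ℕ → Submodule ℂ (P i)
  isInternal : ∀ i, DirectSum.IsInternal (deg i)
  smul_mem : ∀ (i m n : ℕ) (a : A) (x : P i), a ∈ 𝒜 m → x ∈ deg i n → a • x ∈ deg i (m + n)
  projective : ∀ i, Module.Projective A (P i)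
  generated : ∀ i, Submodule.span A (deg i i : Set (P i)) = ⊤
  /-- The differentials. -/
  d : ∀ i, P (i + 1) →ₗ[A] P i
  d_mem : ∀ (i j : ℕ) (x : P (i + 1)), x ∈ deg (i + 1) j → d i x ∈ deg i j
  /-- The augmentation. -/
  ε : P 0 →ₗ[A] A ⧸ (HomogeneousIdeal.irrelevant 𝒜).toIdeal
  ε_eq_zero : ∀ (j : ℕ) (x : P 0), j ≠ 0 → x ∈ deg 0 j → ε x = 0
  exact_d : ∀ i, Function.Exact (d (i + 1)) (d i)
  exact_ε : Function.Exact (d 0) ε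
  surjective_ε : Function.Surjective ε

/-- An `ℕ`-graded algebra `A` is Koszul if `A_0` is semisimple and the graded left `A`-module
`A_0 = A / A_{>0}` has a graded projective resolution whose `i`-th term is generated in
degree `i`. -/
def IsKoszul (𝒜 : ℕ → Submodule ℂ A) [GradedAlgebra 𝒜] : Prop :=
  IsSemisimpleRing (𝒜 0) ∧ Nonempty (LinearResolution 𝒜)

end Koszul

end

/-! Generation in degree one forces the degree zero part to consist of scalars. Semisimplicity is
then automatic, and only linear resolutions have to be transferred. Over such an algebra a graded
projective module generated in degree `n` is free on its component of degree `n`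
(`smulTensor_bijective`), so each term of a linear resolution is `A ⊗ V`.

A resolution is transferred by keeping its spaces and differentials and changing only the action. If
linear automorphisms `θ_γ` of `M` satisfy `θ_γ(a θ_δ(m)) = tw_γ(a) θ_{γ+δ}(m)` for `a` of degree
`δ`, then `b • m := a θ_γ(m)`, with `b` corresponding to `a` of degree `γ`, makes `M` a module over
the twisted algebra. Such systems are built by induction along the resolution, starting from the
identity on `A / A_{>0}`. By linearity the differential is injective on the generators `V`, so the
automorphisms already built restrict to its image and pull back to `V`. They then extend to `A ⊗ V`
because the module is free (`ModuleTwist.exists_lift`). The differentials commute with the systems,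
hence are linear for the new action.

For the converse, `A` is recovered from its twist through the maps `τ_γ⁻¹`. For noncommutative `Γ`
these need not be algebra automorphisms of the twist, so the argument is run for Zhang's twisting
systems, which cover both directions. -/

noncomputable section

/-! ### Homogeneous components of graded vector spaces -/

section GradedProj

variable {ι : Type*} [DecidableEq ι] {M N : Type*} [AddCommGroup M] [Module ℂ M]
  [AddCommGroup N] [Module ℂ N] (D : ι → Submodule ℂ M) [DirectSum.Decomposition D]
  (E : ι → Submodule ℂ N) [DirectSum.Decomposition E]

/-- The projection of a graded vector space onto its component of degree `j`, as an
endomorphism. -/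
def gradedProj (j : ι) : M →ₗ[ℂ] M :=
  (D j).subtype ∘ₗ DirectSum.component ℂ ι (fun i => D i) j ∘ₗ
    (DirectSum.decomposeLinearEquiv D).toLinearMap

theorem gradedProj_mem (j : ι) (x : M) : gradedProj D j x ∈ D j :=
  (DirectSum.decompose D x j).2

variable {D} in
theorem gradedProj_of_mem {j : ι} {x : M} (hx : x ∈ D j) : gradedProj D j x = x :=
  DirectSum.decompose_of_mem_same D hx

variable {D} in
theorem gradedProj_of_mem_ne {i j : ι} {x : M} (hx : x ∈ D i) (hij : i ≠ j) :
    gradedProj D j x = 0 :=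
  DirectSum.decompose_of_mem_ne D hx hij

variable {D E}

theorem gradedProj_map {f : M →ₗ[ℂ] N} (hf : ∀ i x, x ∈ D i → f x ∈ E i) (j : ι) (x : M) :
    gradedProj E j (f x) = f (gradedProj D j x) := by
  induction x using DirectSum.Decomposition.inductionOn D with
  | zero => simp
  | add a b ha hb => simp only [map_add, ha, hb]
  | @homogeneous i x =>
    by_cases hij : i = j
    · subst hij
      rw [gradedProj_of_mem x.2, gradedProj_of_mem (hf _ _ x.2)]
    · rw [gradedProj_of_mem_ne x.2 hij, gradedProj_of_mem_ne (hf _ _ x.2) hij, map_zero]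

theorem exists_mem_map_eq {f : M →ₗ[ℂ] N} (hf : ∀ i x, x ∈ D i → f x ∈ E i) {j : ι} {x : M}
    (hx : f x ∈ E j) : ∃ y ∈ D j, f y = f x :=
  ⟨gradedProj D j x, gradedProj_mem D j x, by rw [← gradedProj_map hf, gradedProj_of_mem hx]⟩

theorem map_mem_iff_of_injective {f : M →ₗ[ℂ] N} (hf : ∀ i x, x ∈ D i → f x ∈ E i)
    (hinj : Function.Injective f) {j : ι} {x : M} : f x ∈ E j ↔ x ∈ D j := by
  refine ⟨fun hx => ?_, hf j x⟩
  obtain ⟨y, hy, hyx⟩ := exists_mem_map_eq hf hx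
  rwa [← hinj hyx]

theorem exists_sum_gradedProj {D : ℕ → Submodule ℂ M} [DirectSum.Decomposition D] (x : M) :
    ∃ n, ∀ m, n ≤ m → ∑ j ∈ Finset.range m, gradedProj D j x = x := by
  induction x using DirectSum.Decomposition.inductionOn D with
  | zero => exact ⟨0, by simp⟩
  | add a b ha hb =>
    obtain ⟨n, hn⟩ := ha
    obtain ⟨k, hk⟩ := hb
    refine ⟨max n k, fun m hm => ?_⟩
    simp only [map_add, Finset.sum_add_distrib]
    rw [hn m (le_trans (le_max_left _ _) hm), hk m (le_trans (le_max_right _ _) hm)]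
  | @homogeneous i x =>
    refine ⟨i + 1, fun m hm => ?_⟩
    rw [Finset.sum_eq_single_of_mem i (Finset.mem_range.2 hm)
      (fun j _ hj => gradedProj_of_mem_ne x.2 hj.symm), gradedProj_of_mem x.2]

end GradedProj

/-! ### Graded projective modules generated in a single degree -/

section SmulTensor

open TensorProduct

variable {A : Type*} [Ring A] [Algebra ℂ A] {P : Type*} [AddCommGroup P] [Module ℂ P]
  [Module A P] [IsScalarTower ℂ A P]

variable (A) in
/-- The `A`-linear map `A ⊗ V → P`, `a ⊗ v ↦ a • v`, for a subspace `V` of an `A`-module `P`. -/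
def smulTensor (V : Submodule ℂ P) : A ⊗[ℂ] V →ₗ[A] P where
  __ := TensorProduct.lift ((Algebra.lsmul ℂ ℂ P).toLinearMap.compl₂ V.subtype)
  map_smul' a x := by
    induction x with
    | zero => simp
    | add x y hx hy => simp_all
    | tmul b v => simp [TensorProduct.smul_tmul']

@[simp]
theorem smulTensor_tmul (V : Submodule ℂ P) (a : A) (v : V) :
    smulTensor A V (a ⊗ₜ v) = a • (v : P) := rfl

theorem smulTensor_surjective {V : Submodule ℂ P} (hV : Submodule.span A (V : Set P) = ⊤) :
    Function.Surjective (smulTensor A V) := by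
  rw [← LinearMap.range_eq_top, ← top_le_iff, ← hV, Submodule.span_le]
  intro v hv
  exact ⟨1 ⊗ₜ ⟨v, hv⟩, by simp⟩

theorem span_homogeneous_induction {ι : Type*} [DecidableEq ι] (𝒜 : ι → Submodule ℂ A)
    [DirectSum.Decomposition 𝒜] {V : Submodule ℂ P} (hV : Submodule.span A (V : Set P) = ⊤)
    {p : P → Prop} (zero : p 0) (add : ∀ x y, p x → p y → p (x + y))
    (smul : ∀ i, ∀ a ∈ 𝒜 i, ∀ v ∈ V, p (a • v)) (x : P) : p x := by
  obtain ⟨x, rfl⟩ := smulTensor_surjective hV x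
  induction x with
  | zero => simpa
  | add x y hx hy => rw [map_add]; exact add _ _ hx hy
  | tmul a v =>
    rw [smulTensor_tmul]
    induction a using DirectSum.Decomposition.inductionOn 𝒜 with
    | zero => simpa
    | add a b ha hb => rw [add_smul]; exact add _ _ ha hb
    | homogeneous a => exact smul _ _ a.2 _ v.2

variable {𝒞 : ℕ → Submodule ℂ A} [GradedAlgebra 𝒞] {D : ℕ → Submodule ℂ P}
  [DirectSum.Decomposition D] {n : ℕ}

theorem eq_zero_of_mem_of_lt
    (hsmul : ∀ (m k : ℕ) (a : A) (x : P), a ∈ 𝒞 m → x ∈ D k → a • x ∈ D (m + k))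
    (hD : Submodule.span A (D n : Set P) = ⊤) {j : ℕ} (hj : j < n) {x : P} (hx : x ∈ D j) :
    x = 0 := by
  rw [← gradedProj_of_mem hx]
  clear hx
  induction x using span_homogeneous_induction 𝒞 hD with
  | zero => simp
  | add x y hx hy => rw [map_add, hx, hy, add_zero]
  | smul i a ha v hv => exact gradedProj_of_mem_ne (hsmul _ _ _ _ ha hv) (by omega)

/-- `A ⊗ V` is graded through its first factor, with `V` in degree `0`; multiplication by `a` shifts
this grading by `m`. -/
theorem rTensor_gradedProj_smul {V : Type*} [AddCommGroup V] [Module ℂ V] {m : ℕ} {a : A}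
    (ha : a ∈ 𝒞 m) (j : ℕ) (x : A ⊗[ℂ] V) :
    (gradedProj 𝒞 j).rTensor V (a • x) =
      if m ≤ j then a • (gradedProj 𝒞 (j - m)).rTensor V x else 0 := by
  induction x with
  | zero => simp
  | add x y hx hy =>
    rw [smul_add, map_add, hx, hy]
    split_ifs <;> simp
  | tmul b v =>
    rw [TensorProduct.smul_tmul', LinearMap.rTensor_tmul, LinearMap.rTensor_tmul, smul_eq_mul]
    induction b using DirectSum.Decomposition.inductionOn 𝒞 with
    | zero => simp
    | add b c hb hc =>
      rw [mul_add, map_add, TensorProduct.add_tmul, hb, hc, map_add, TensorProduct.add_tmul]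
      split_ifs <;> simp
    | @homogeneous k b =>
      have hab := SetLike.mul_mem_graded ha b.2
      by_cases hj : m + k = j
      · subst hj
        rw [gradedProj_of_mem hab, if_pos (by omega), Nat.add_sub_cancel_left,
          gradedProj_of_mem b.2, TensorProduct.smul_tmul', smul_eq_mul]
      · rw [gradedProj_of_mem_ne hab hj, TensorProduct.zero_tmul]
        split_ifs
        · rw [gradedProj_of_mem_ne b.2 (by omega), TensorProduct.zero_tmul, smul_zero]
        · rfl

theorem eq_zero_of_rTensor_gradedProj {V : Type*} [AddCommGroup V] [Module ℂ V] {x : A ⊗[ℂ] V}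
    (hx : ∀ j, (gradedProj 𝒞 j).rTensor V x = 0) : x = 0 := by
  have key : ∃ n, ∀ m, n ≤ m →
      ∑ j ∈ Finset.range m, (gradedProj 𝒞 j).rTensor V x = x := by
    clear hx
    induction x with
    | zero => exact ⟨0, by simp⟩
    | add x y hx hy =>
      obtain ⟨n, hn⟩ := hx
      obtain ⟨k, hk⟩ := hy
      refine ⟨max n k, fun m hm => ?_⟩
      simp only [map_add, Finset.sum_add_distrib]
      rw [hn m (le_trans (le_max_left _ _) hm), hk m (le_trans (le_max_right _ _) hm)]
    | tmul a v =>
      obtain ⟨n, hn⟩ := exists_sum_gradedProj (D := 𝒞) a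
      refine ⟨n, fun m hm => ?_⟩
      simp only [LinearMap.rTensor_tmul]
      rw [← TensorProduct.sum_tmul, hn m hm]
  obtain ⟨n, hn⟩ := key
  rw [← hn n le_rfl]
  exact Finset.sum_eq_zero fun j _ => hx j

/-- Over a connected graded algebra, a graded projective module generated in a single degree is
free on its component of that degree. -/
theorem smulTensor_bijective [Module.Projective A P]
    (h0 : ∀ a ∈ 𝒞 0, ∃ c : ℂ, algebraMap ℂ A c = a)
    (hsmul : ∀ (m k : ℕ) (a : A) (x : P), a ∈ 𝒞 m → x ∈ D k → a • x ∈ D (m + k))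
    (hD : Submodule.span A (D n : Set P) = ⊤) :
    Function.Bijective (smulTensor A (D n)) := by
  have hsurj := smulTensor_surjective hD
  refine ⟨?_, hsurj⟩
  -- The section `s` need not respect the gradings; the argument below only uses that it is
  -- `A`-linear.
  obtain ⟨s, hs⟩ := LinearMap.exists_rightInverse_of_surjective (smulTensor A (D n))
    (LinearMap.range_eq_top.2 hsurj)
  have hs' : ∀ x, smulTensor A (D n) (s x) = x := fun x => LinearMap.congr_fun hs x
  -- the degree zero part of the tensor product is `1 ⊗ V`
  have hone : ∀ x : A ⊗[ℂ] D n, ∃ w : D n, (gradedProj 𝒞 0).rTensor (D n) x = 1 ⊗ₜ w := by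
    intro x
    induction x with
    | zero => exact ⟨0, by simp⟩
    | add x y hx hy =>
      obtain ⟨w, hw⟩ := hx
      obtain ⟨w', hw'⟩ := hy
      exact ⟨w + w', by rw [map_add, hw, hw', TensorProduct.tmul_add]⟩
    | tmul a v =>
      obtain ⟨c, hc⟩ := h0 _ (gradedProj_mem 𝒞 0 a)
      refine ⟨c • v, ?_⟩
      rw [LinearMap.rTensor_tmul, ← hc, Algebra.algebraMap_eq_smul_one, TensorProduct.smul_tmul]
  have hproj : ∀ x : A ⊗[ℂ] D n,
      smulTensor A (D n) ((gradedProj 𝒞 0).rTensor (D n) x) =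
        gradedProj D n (smulTensor A (D n) x) := by
    intro x
    induction x with
    | zero => simp
    | add x y hx hy => simp only [map_add, hx, hy]
    | tmul a v =>
      simp only [LinearMap.rTensor_tmul, smulTensor_tmul]
      induction a using DirectSum.Decomposition.inductionOn 𝒞 with
      | zero => simp
      | add a b ha hb => simp only [map_add, add_smul, ha, hb]
      | @homogeneous m a =>
        have hav := hsmul _ _ _ _ a.2 v.2
        by_cases hm : m = 0
        · subst hm
          rw [zero_add] at hav
          rw [gradedProj_of_mem a.2, gradedProj_of_mem hav]
        · rw [gradedProj_of_mem_ne a.2 hm, gradedProj_of_mem_ne hav (by omega), zero_smul]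
  -- In degree zero the multiplication map is `1 ⊗ w ↦ w`, which is injective.
  have hker0 : ∀ x, smulTensor A (D n) x = 0 → (gradedProj 𝒞 0).rTensor (D n) x = 0 := by
    intro x hx
    obtain ⟨w, hw⟩ := hone x
    have := hproj x
    rw [hw, hx, smulTensor_tmul, one_smul, map_zero] at this
    rw [hw, (Subtype.ext this : w = 0), TensorProduct.tmul_zero]
  -- the projection onto the kernel
  set q : A ⊗[ℂ] D n →ₗ[A] A ⊗[ℂ] D n := LinearMap.id - s ∘ₗ smulTensor A (D n) with hq
  have hqker : ∀ x, smulTensor A (D n) (q x) = 0 := fun x => by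
    simp [hq, hs']
  have hqid : ∀ x, smulTensor A (D n) x = 0 → q x = x := fun x hx => by simp [hq, hx]
  -- A Nakayama argument: the kernel `K` has no component of degree zero, and projecting by `q`
  -- shows that it lies in `A_{>0} K`. Each round therefore raises the lowest possible degree of an
  -- element of `K` by at least one.
  have hfilt : ∀ k x, smulTensor A (D n) x = 0 →
      ∀ j < k, (gradedProj 𝒞 j).rTensor (D n) x = 0 := by
    intro k
    induction k with
    | zero => intro x _ j hj; omega
    | succ k ih =>
      have key : ∀ x : A ⊗[ℂ] D n, ∀ j < k + 1, (gradedProj 𝒞 j).rTensor (D n)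
          (q (x - (gradedProj 𝒞 0).rTensor (D n) x)) = 0 := by
        intro x j hj
        induction x with
        | zero => simp
        | add x y hx hy =>
          have : x + y - (gradedProj 𝒞 0).rTensor (D n) (x + y) =
            (x - (gradedProj 𝒞 0).rTensor (D n) x) +
              (y - (gradedProj 𝒞 0).rTensor (D n) y) := by rw [map_add]; abel
          rw [this, map_add, map_add, hx, hy, add_zero]
        | tmul a v =>
          rw [LinearMap.rTensor_tmul, ← TensorProduct.sub_tmul]
          induction a using DirectSum.Decomposition.inductionOn 𝒞 with
          | zero => simp
          | add a b ha hb =>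
            have : a + b - gradedProj 𝒞 0 (a + b) =
              (a - gradedProj 𝒞 0 a) + (b - gradedProj 𝒞 0 b) := by rw [map_add]; abel
            rw [this, TensorProduct.add_tmul, map_add, map_add, ha, hb, add_zero]
          | @homogeneous m a =>
            by_cases hm : m = 0
            · subst hm
              simp [gradedProj_of_mem a.2]
            -- By linearity `q (a ⊗ v) = a • q (1 ⊗ v)`, where `q (1 ⊗ v)` lies in the kernel and
            -- `a` has degree `m ≥ 1`; the induction hypothesis is needed only in degrees `j - m <
            -- k`.
            · have : (a : A) ⊗ₜ[ℂ] v = (a : A) • ((1 : A) ⊗ₜ[ℂ] v) := by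
                rw [TensorProduct.smul_tmul', smul_eq_mul, mul_one]
              rw [gradedProj_of_mem_ne a.2 hm, sub_zero, this, map_smul,
                rTensor_gradedProj_smul a.2]
              split_ifs
              · rw [ih _ (hqker _) _ (by omega), smul_zero]
              · rfl
      intro x hx j hj
      have := key x j hj
      rwa [hker0 x hx, sub_zero, hqid x hx] at this
  rw [injective_iff_map_eq_zero]
  intro x hx
  exact eq_zero_of_rTensor_gradedProj fun j => hfilt (j + 1) x hx j (Nat.lt_succ_self j)

end SmulTensor

/-! ### Connectedness of algebras generated in degree one -/

section Connected

variable {A : Type*} [Ring A] [Algebra ℂ A] (𝒞 : ℕ → Submodule ℂ A) [GradedAlgebra 𝒞]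

/-- The projection onto degree zero is a ring homomorphism that kills the generators and fixes
scalars, so its image consists of scalars. -/
theorem exists_algebraMap_eq_of_adjoin_eq_top
    (hA : Algebra.adjoin ℂ (𝒞 1 : Set A) = ⊤) (a : A) (ha : a ∈ 𝒞 0) :
    ∃ c : ℂ, algebraMap ℂ A c = a := by
  suffices H : GradedRing.projZeroRingHom 𝒞 a ∈ (⊥ : Subalgebra ℂ A) by
    rw [GradedRing.projZeroRingHom_apply, DirectSum.decompose_of_mem_same 𝒞 ha] at H
    exact Algebra.mem_bot.1 H
  have h : a ∈ Algebra.adjoin ℂ (𝒞 1 : Set A) := hA ▸ Algebra.mem_top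
  clear ha
  induction h using Algebra.adjoin_induction with
  | mem x hx =>
    rw [GradedRing.projZeroRingHom_apply, DirectSum.decompose_of_mem_ne 𝒞 hx one_ne_zero]
    exact zero_mem _
  | algebraMap r =>
    rw [GradedRing.projZeroRingHom_apply,
      DirectSum.decompose_of_mem_same 𝒞 (SetLike.algebraMap_mem_graded 𝒞 r)]
    exact Subalgebra.algebraMap_mem _ r
  | add x y _ _ hx hy => rw [map_add]; exact add_mem hx hy
  | mul x y _ _ hx hy => rw [map_mul]; exact mul_mem hx hy

theorem isSemisimpleRing_zero (h0 : ∀ a ∈ 𝒞 0, ∃ c : ℂ, algebraMap ℂ A c = a) :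
    IsSemisimpleRing (𝒞 0) := by
  refine RingHom.isSemisimpleRing_of_surjective (algebraMap ℂ (𝒞 0)) ?_
  rintro ⟨a, ha⟩
  obtain ⟨c, rfl⟩ := h0 a ha
  exact ⟨c, rfl⟩

end Connected

/-! ### Bilinear maps and tensor products twisted by the degree -/

section TwistBilin

open TensorProduct

variable {Γ : Type*} [DecidableEq Γ] {A : Type*} [AddCommGroup A] [Module ℂ A]
  (𝒜 : Γ → Submodule ℂ A) [DirectSum.Decomposition 𝒜]
  {L M N V : Type*} [AddCommGroup L] [Module ℂ L] [AddCommGroup M] [Module ℂ M]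
  [AddCommGroup N] [Module ℂ N] [AddCommGroup V] [Module ℂ V]

/-- The bilinear map `(a, l) ↦ f a (ψ γ l)` for `a` of degree `γ`. -/
def twistBilin (f : A →ₗ[ℂ] M →ₗ[ℂ] N) (ψ : Γ → L →ₗ[ℂ] M) : A →ₗ[ℂ] L →ₗ[ℂ] N :=
  DirectSum.toModule ℂ Γ (L →ₗ[ℂ] N) (fun γ => f.compl₂ (ψ γ) ∘ₗ (𝒜 γ).subtype) ∘ₗ
    (DirectSum.decomposeLinearEquiv 𝒜).toLinearMap

variable {𝒜} in
theorem twistBilin_of_mem (f : A →ₗ[ℂ] M →ₗ[ℂ] N) (ψ : Γ → L →ₗ[ℂ] M) {γ : Γ} {a : A}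
    (ha : a ∈ 𝒜 γ) (l : L) : twistBilin 𝒜 f ψ a l = f a (ψ γ l) := by
  lift a to 𝒜 γ using ha
  simp [twistBilin]

/-- The endomorphism `a ⊗ v ↦ t a ⊗ ψ γ v` (`a` of degree `γ`) of `A ⊗ V`. -/
def twistTensor (t : A →ₗ[ℂ] A) (ψ : Γ → V →ₗ[ℂ] V) : A ⊗[ℂ] V →ₗ[ℂ] A ⊗[ℂ] V :=
  TensorProduct.lift (twistBilin 𝒜 (TensorProduct.mk ℂ A V ∘ₗ t) ψ)

variable {𝒜} in
theorem twistTensor_tmul (t : A →ₗ[ℂ] A) (ψ : Γ → V →ₗ[ℂ] V) {γ : Γ} {a : A}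
    (ha : a ∈ 𝒜 γ) (v : V) : twistTensor 𝒜 t ψ (a ⊗ₜ v) = t a ⊗ₜ ψ γ v := by
  simp [twistTensor, twistBilin_of_mem _ _ ha]

theorem tensor_homogeneous_induction {p : A ⊗[ℂ] V → Prop} (zero : p 0)
    (add : ∀ x y, p x → p y → p (x + y)) (tmul : ∀ γ, ∀ a ∈ 𝒜 γ, ∀ v, p (a ⊗ₜ v))
    (x : A ⊗[ℂ] V) : p x := by
  induction x with
  | zero => exact zero
  | add x y hx hy => exact add _ _ hx hy
  | tmul a v =>
    induction a using DirectSum.Decomposition.inductionOn 𝒜 with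
    | zero => rwa [TensorProduct.zero_tmul]
    | add a b ha hb => rw [TensorProduct.add_tmul]; exact add _ _ ha hb
    | homogeneous a => exact tmul _ _ a.2 _

theorem twistTensor_twistTensor {t t' : A →ₗ[ℂ] A} {ψ ψ' : Γ → V →ₗ[ℂ] V}
    (ht : ∀ γ a, a ∈ 𝒜 γ → t a ∈ 𝒜 γ) (htt : ∀ a, t' (t a) = a)
    (hψ : ∀ γ v, ψ' γ (ψ γ v) = v) (x : A ⊗[ℂ] V) :
    twistTensor 𝒜 t' ψ' (twistTensor 𝒜 t ψ x) = x := by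
  induction x using tensor_homogeneous_induction (V := V) 𝒜 with
  | zero => simp
  | add x y hx hy => rw [map_add, map_add, hx, hy]
  | tmul γ a ha v => rw [twistTensor_tmul _ _ ha, twistTensor_tmul _ _ (ht _ _ ha), htt, hψ]

theorem twistTensor_bijective {t : A ≃ₗ[ℂ] A} (ht : ∀ γ a, a ∈ 𝒜 γ → t a ∈ 𝒜 γ)
    (ψ : Γ → V ≃ₗ[ℂ] V) :
    Function.Bijective (twistTensor 𝒜 t.toLinearMap fun γ => (ψ γ).toLinearMap) := by
  have ht' : ∀ γ a, a ∈ 𝒜 γ → t.symm a ∈ 𝒜 γ := fun γ a ha =>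
    (map_mem_iff_of_injective (f := t.toLinearMap) ht t.injective).1 (by simpa using ha)
  refine Function.bijective_iff_has_inverse.2
    ⟨twistTensor 𝒜 t.symm.toLinearMap fun γ => (ψ γ).symm.toLinearMap, ?_, ?_⟩
  · exact twistTensor_twistTensor 𝒜 ht (by simp) (by simp)
  · exact twistTensor_twistTensor 𝒜 ht' (by simp) (by simp)

end TwistBilin

/-! ### Zhang twists and twisting systems on modules -/

/-- An identification of a `Γ`-graded algebra `B` with the twist of a `Γ`-graded algebra `A` by a
twisting system in the sense of Zhang: a family of graded linear automorphisms `tw γ` of `A`, not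
necessarily multiplicative in either argument, such that the product of `B` is `x * tw γ y` for
`x` of degree `γ`. Unlike twists by families of algebra automorphisms, these are stable under
exchanging `A` and `B`. -/
structure ZhangTwist {Γ : Type*} [AddMonoid Γ] {A B : Type*} [Ring A] [Algebra ℂ A] [Ring B]
    [Algebra ℂ B] (𝒜 : Γ → Submodule ℂ A) (ℬ : Γ → Submodule ℂ B) where
  /-- The identification of the underlying vector spaces. -/
  equiv : A ≃ₗ[ℂ] B
  equiv_mem_iff : ∀ (γ : Γ) (a : A), equiv a ∈ ℬ γ ↔ a ∈ 𝒜 γ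
  equiv_one : equiv 1 = 1
  /-- The twisting system. -/
  tw : Γ → A ≃ₗ[ℂ] A
  tw_mem : ∀ (γ δ : Γ) (a : A), a ∈ 𝒜 δ → tw γ a ∈ 𝒜 δ
  tw_one : ∀ γ, tw γ 1 = 1
  tw_mul : ∀ (γ δ : Γ) (a b : A), a ∈ 𝒜 δ → tw γ (a * tw δ b) = tw γ a * tw (γ + δ) b
  equiv_mul : ∀ (γ : Γ) (a b : A), a ∈ 𝒜 γ → equiv (a * tw γ b) = equiv a * equiv b

namespace ZhangTwist

variable {Γ : Type*} [AddMonoid Γ] {A B : Type*} [Ring A] [Algebra ℂ A] [Ring B]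
    [Algebra ℂ B] {𝒜 : Γ → Submodule ℂ A} {ℬ : Γ → Submodule ℂ B} (Z : ZhangTwist 𝒜 ℬ)

/-- A twisting system on an `A`-module compatible with a twisting system on `A`. -/
structure ModuleTwist (M : Type*) [AddCommGroup M] [Module ℂ M] [Module A M] where
  /-- The linear automorphisms. -/
  tw : Γ → M ≃ₗ[ℂ] M
  tw_smul : ∀ (γ δ : Γ) (a : A) (m : M), a ∈ 𝒜 δ →
    tw γ (a • tw δ m) = Z.tw γ a • tw (γ + δ) m

variable [DecidableEq Γ] [GradedAlgebra 𝒜]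

/-- The twisting identity at `1` says that `tw 0` is idempotent, and an injective idempotent map is
the identity. -/
theorem tw_zero (a : A) : Z.tw 0 a = a := by
  have := Z.tw_mul 0 0 1 a SetLike.GradedOne.one_mem
  rw [one_mul, Z.tw_one, one_mul, add_zero] at this
  exact (Z.tw 0).injective this

theorem equiv_homogeneous_induction {p : B → Prop} (zero : p 0)
    (add : ∀ x y, p x → p y → p (x + y)) (equiv : ∀ γ, ∀ a ∈ 𝒜 γ, p (Z.equiv a)) (b : B) :
    p b := by
  obtain ⟨a, rfl⟩ := Z.equiv.surjective b
  induction a using DirectSum.Decomposition.inductionOn 𝒜 with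
  | zero => rwa [map_zero]
  | add a b ha hb => rw [map_add]; exact add _ _ ha hb
  | homogeneous a => exact equiv _ _ a.2

variable {Z} {M : Type*} [AddCommGroup M] [Module ℂ M] [Module A M]

theorem ModuleTwist.tw_zero (θ : Z.ModuleTwist M) (m : M) : θ.tw 0 m = m := by
  have := θ.tw_smul 0 0 1 m SetLike.GradedOne.one_mem
  rw [one_smul, Z.tw_one, one_smul, add_zero] at this
  exact (θ.tw 0).injective this

section Lift

open TensorProduct

variable {P : Type*} [AddCommGroup P] [Module ℂ P] [Module A P] [IsScalarTower ℂ A P]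

/-- For a subspace `V` freely generating `P` and automorphisms `ψ γ` of `V`, the map
`A ⊗ V → P` sending `a ⊗ v` to `tw γ a • ψ (γ + δ) v` for `a` of degree `δ`. -/
def freeTwist (Z : ZhangTwist 𝒜 ℬ) {V : Submodule ℂ P}
    (hV : Function.Bijective (smulTensor A V)) (ψ : Γ → V ≃ₗ[ℂ] V) (γ : Γ) :
    A ⊗[ℂ] V ≃ₗ[ℂ] P :=
  LinearEquiv.ofBijective _ (twistTensor_bijective 𝒜 (Z.tw_mem γ) fun δ => ψ (γ + δ)) ≪≫ₗ
    LinearEquiv.ofBijective ((smulTensor A V).restrictScalars ℂ) hV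

theorem freeTwist_tmul {V : Submodule ℂ P} (hV : Function.Bijective (smulTensor A V))
    (ψ : Γ → V ≃ₗ[ℂ] V) (γ : Γ) {δ : Γ} {a : A} (ha : a ∈ 𝒜 δ) (v : V) :
    freeTwist Z hV ψ γ (a ⊗ₜ v) = Z.tw γ a • (ψ (γ + δ) v : P) := by
  simp only [freeTwist, LinearEquiv.trans_apply, LinearEquiv.ofBijective_apply,
    twistTensor_tmul _ _ ha]
  rfl

/-- The index `γ + δ` in `freeTwist` is chosen so that this holds for arbitrary `ψ`: no cocycle
condition on `V` is required. -/
theorem smul_freeTwist {V : Submodule ℂ P} (hV : Function.Bijective (smulTensor A V))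
    (ψ : Γ → V ≃ₗ[ℂ] V) (γ : Γ) {δ : Γ} {a : A} (ha : a ∈ 𝒜 δ) (x : A ⊗[ℂ] V) :
    freeTwist Z hV ψ γ ((freeTwist Z hV ψ 0).symm (a • freeTwist Z hV ψ δ x)) =
      Z.tw γ a • freeTwist Z hV ψ (γ + δ) x := by
  induction x using tensor_homogeneous_induction (V := V) 𝒜 with
  | zero => simp
  | add x y hx hy => simp only [map_add, smul_add, hx, hy]
  | tmul ε b hb v =>
    have hab : a * Z.tw δ b ∈ 𝒜 (δ + ε) := SetLike.mul_mem_graded ha (Z.tw_mem _ _ _ hb)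
    have : a • freeTwist Z hV ψ δ (b ⊗ₜ v) = freeTwist Z hV ψ 0 ((a * Z.tw δ b) ⊗ₜ v) := by
      rw [freeTwist_tmul hV ψ δ hb, freeTwist_tmul hV ψ 0 hab, Z.tw_zero, zero_add, mul_smul]
    rw [this, LinearEquiv.symm_apply_apply, freeTwist_tmul hV ψ γ hab,
      freeTwist_tmul hV ψ _ hb, Z.tw_mul _ _ _ _ ha, mul_smul, add_assoc]

/-- A twisting system on a module freely generated by a subspace `V`, from automorphisms of
`V`. -/
def ModuleTwist.ofFree (Z : ZhangTwist 𝒜 ℬ) {V : Submodule ℂ P}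
    (hV : Function.Bijective (smulTensor A V)) (ψ : Γ → V ≃ₗ[ℂ] V) : Z.ModuleTwist P where
  tw γ := (freeTwist Z hV ψ 0).symm ≪≫ₗ freeTwist Z hV ψ γ
  tw_smul γ δ a m ha := by
    simp only [LinearEquiv.trans_apply]
    exact smul_freeTwist hV ψ γ ha _

theorem ModuleTwist.ofFree_freeTwist {V : Submodule ℂ P}
    (hV : Function.Bijective (smulTensor A V)) (ψ : Γ → V ≃ₗ[ℂ] V) (γ : Γ) (x : A ⊗[ℂ] V) :
    (ModuleTwist.ofFree Z hV ψ).tw γ (freeTwist Z hV ψ 0 x) = freeTwist Z hV ψ γ x := by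
  simp [ModuleTwist.ofFree]

/-- As `d` is injective on `V` and `θ` preserves `d(V)`, each `θ_γ` pulls back to an automorphism of
`V`, which extends to `P` by freeness. The last clause serves to show that the lift respects
degrees. -/
theorem ModuleTwist.exists_lift {V : Submodule ℂ P}
    (hV : Function.Bijective (smulTensor A V)) (d : P →ₗ[A] M) [IsScalarTower ℂ A M]
    (θ : Z.ModuleTwist M) (hd : ∀ v ∈ V, d v = 0 → v = 0)
    (hθ : ∀ γ m, (∃ v ∈ V, d v = θ.tw γ m) ↔ ∃ v ∈ V, d v = m) :
    ∃ θ' : Z.ModuleTwist P, (∀ γ x, d (θ'.tw γ x) = θ.tw γ (d x)) ∧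
      ∀ γ δ, ∀ a ∈ 𝒜 δ, ∀ v ∈ V, ∃ a' ∈ 𝒜 δ, ∃ v' ∈ V, θ'.tw γ (a • v) = a' • v' := by
  set f : V →ₗ[ℂ] M := d.restrictScalars ℂ ∘ₗ V.subtype with hf
  have hfinj : Function.Injective f := by
    rw [injective_iff_map_eq_zero]
    intro v hv
    exact Subtype.ext (hd v v.2 hv)
  have hrange : ∀ γ, (LinearMap.range f).map (θ.tw γ).toLinearMap = LinearMap.range f := by
    intro γ
    have hmem : ∀ m, m ∈ LinearMap.range f ↔ ∃ v ∈ V, d v = m := fun m => by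
      simp [hf]
    ext m
    rw [hmem, Submodule.mem_map]
    constructor
    · rintro ⟨m', hm', rfl⟩
      exact (hθ γ m').2 ((hmem m').1 hm')
    · rintro hm
      refine ⟨(θ.tw γ).symm m, (hmem _).2 ((hθ γ _).1 (by simpa using hm)), by simp⟩
  let e := LinearEquiv.ofInjective f hfinj
  let ψ : Γ → V ≃ₗ[ℂ] V := fun γ =>
    e ≪≫ₗ (θ.tw γ).ofSubmodules _ _ (hrange γ) ≪≫ₗ e.symm
  have hψ : ∀ γ v, d (ψ γ v : P) = θ.tw γ (d v) := by
    intro γ v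
    have : e (ψ γ v) = (θ.tw γ).ofSubmodules _ _ (hrange γ) (e v) := by simp [ψ]
    exact congrArg Subtype.val this
  refine ⟨ModuleTwist.ofFree Z hV ψ, fun γ x => ?_, fun γ δ a ha v hv => ?_⟩
  · obtain ⟨x, rfl⟩ := (freeTwist Z hV ψ 0).surjective x
    rw [ModuleTwist.ofFree_freeTwist]
    induction x using tensor_homogeneous_induction (V := V) 𝒜 with
    | zero => simp
    | add x y hx hy => simp only [map_add, hx, hy]
    | tmul δ a ha v =>
      rw [freeTwist_tmul hV ψ γ ha, freeTwist_tmul hV ψ 0 ha, Z.tw_zero, zero_add, map_smul,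
        map_smul, hψ, hψ, θ.tw_smul _ _ _ _ ha]
  -- To apply the lift, `a • v` is first written as the image of `a ⊗ ψ_δ⁻¹(v)` under `freeTwist` at
  -- `0`; passing to index `γ` then replaces `ψ_δ` by `ψ_{γ+δ}`.
  · refine ⟨Z.tw γ a, Z.tw_mem _ _ _ ha, ψ (γ + δ) ((ψ δ).symm ⟨v, hv⟩), Subtype.coe_prop _, ?_⟩
    have : a • v = freeTwist Z hV ψ 0 (a ⊗ₜ (ψ δ).symm ⟨v, hv⟩) := by
      rw [freeTwist_tmul hV ψ 0 ha, Z.tw_zero, zero_add, LinearEquiv.apply_symm_apply]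
    rw [this, ModuleTwist.ofFree_freeTwist, freeTwist_tmul hV ψ γ ha]

end Lift

section Module

variable [IsScalarTower ℂ A M] (θ : Z.ModuleTwist M)

/-- The action of the twisted algebra on an `A`-module with a twisting system:
`b • m = a • tw γ m` if `b` corresponds to `a` of degree `γ`. -/
def ModuleTwist.act : B →ₗ[ℂ] M →ₗ[ℂ] M :=
  twistBilin 𝒜 (Algebra.lsmul ℂ ℂ M).toLinearMap (fun γ => (θ.tw γ).toLinearMap) ∘ₗ
    Z.equiv.symm.toLinearMap

theorem ModuleTwist.act_equiv {γ : Γ} {a : A} (ha : a ∈ 𝒜 γ) (m : M) :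
    θ.act (Z.equiv a) m = a • θ.tw γ m := by
  simp [ModuleTwist.act, twistBilin_of_mem _ _ ha]

/-- The module over the twisted algebra defined by a twisting system. -/
abbrev ModuleTwist.module : Module B M where
  smul b m := θ.act b m
  one_smul m := by
    change θ.act 1 m = m
    rw [← Z.equiv_one, θ.act_equiv SetLike.GradedOne.one_mem, one_smul, θ.tw_zero]
  mul_smul b c m := by
    change θ.act (b * c) m = θ.act b (θ.act c m)
    induction b using Z.equiv_homogeneous_induction with
    | zero => simp
    | add x y hx hy => simp only [add_mul, map_add, LinearMap.add_apply, hx, hy]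
    | equiv γ a ha =>
      induction c using Z.equiv_homogeneous_induction with
      | zero => simp
      | add x y hx hy => simp only [mul_add, map_add, LinearMap.add_apply, hx, hy]
      | equiv δ b hb =>
        rw [← Z.equiv_mul _ _ _ ha,
          θ.act_equiv (SetLike.mul_mem_graded ha (Z.tw_mem _ _ _ hb)), θ.act_equiv ha,
          θ.act_equiv hb, θ.tw_smul _ _ _ _ hb, mul_smul]
  smul_zero b := map_zero (θ.act b)
  smul_add b := map_add (θ.act b)
  add_smul b c m := LinearMap.map_add₂ θ.act b c m
  zero_smul m := LinearMap.map_zero₂ θ.act m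

theorem ModuleTwist.equiv_smul {γ : Γ} {a : A} (ha : a ∈ 𝒜 γ) (m : M) :
    letI := θ.module
    Z.equiv a • m = a • θ.tw γ m :=
  θ.act_equiv ha m

theorem ModuleTwist.isScalarTower :
    letI := θ.module
    IsScalarTower ℂ B M :=
  letI := θ.module
  ⟨fun c b m => LinearMap.map_smul₂ θ.act c b m⟩

-- The subspace `V` still generates freely after twisting: up to `A ⊗ V ≃ B ⊗ V`, the multiplication
-- map of `B` is `freeTwist` at `0` for the restrictions of `θ` to `V`, hence bijective.
open TensorProduct in
theorem ModuleTwist.projective {V : Submodule ℂ M} (hV : Function.Bijective (smulTensor A V))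
    (hθ : ∀ γ x, θ.tw γ x ∈ V ↔ x ∈ V) :
    letI := θ.module
    Module.Projective B M := by
  let := θ.module
  have := θ.isScalarTower
  have hmap : ∀ γ, V.map (θ.tw γ).toLinearMap = V := fun γ => by
    ext x
    rw [Submodule.mem_map]
    constructor
    · rintro ⟨y, hy, rfl⟩
      exact (hθ γ y).2 hy
    · intro hx
      exact ⟨(θ.tw γ).symm x, (hθ γ _).1 (by simpa using hx), by simp⟩
  let ψ : Γ → V ≃ₗ[ℂ] V := fun γ => (θ.tw γ).ofSubmodules V V (hmap γ)
  have hcomp : ∀ x : A ⊗[ℂ] V,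
      smulTensor B V (LinearEquiv.rTensor V Z.equiv x) = freeTwist Z hV ψ 0 x := by
    intro x
    induction x using tensor_homogeneous_induction (V := V) 𝒜 with
    | zero => simp
    | add x y hx hy => simp only [map_add, hx, hy]
    | tmul δ a ha v =>
      rw [freeTwist_tmul hV ψ 0 ha, Z.tw_zero, zero_add, LinearEquiv.rTensor_tmul,
        smulTensor_tmul, θ.equiv_smul ha]
      rfl
  have hbij : Function.Bijective (smulTensor B V) := by
    rw [← Function.Bijective.of_comp_iff _ (LinearEquiv.rTensor V Z.equiv).bijective,
      show smulTensor B V ∘ LinearEquiv.rTensor V Z.equiv = freeTwist Z hV ψ 0 from funext hcomp]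
    exact (freeTwist Z hV ψ 0).bijective
  exact Module.Projective.of_equiv (LinearEquiv.ofBijective (smulTensor B V) hbij)

end Module

end ZhangTwist

/-! ### The irrelevant ideal and the trivial module -/

section Irrelevant

variable {A : Type*} [Ring A] [Algebra ℂ A] {𝒞 : ℕ → Submodule ℂ A} [GradedAlgebra 𝒞]

theorem mem_irrelevant_iff_projZero (a : A) :
    a ∈ (HomogeneousIdeal.irrelevant 𝒞).toIdeal ↔ GradedRing.projZeroRingHom 𝒞 a = 0 :=
  HomogeneousIdeal.mem_irrelevant_iff 𝒞 a

theorem smul_quotient_irrelevant_eq_zero {n : ℕ} (hn : n ≠ 0) {a : A} (ha : a ∈ 𝒞 n)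
    (m : A ⧸ (HomogeneousIdeal.irrelevant 𝒞).toIdeal) : a • m = 0 := by
  obtain ⟨x, rfl⟩ := Submodule.Quotient.mk_surjective _ m
  rw [← Submodule.Quotient.mk_smul, Submodule.Quotient.mk_eq_zero, mem_irrelevant_iff_projZero,
    smul_eq_mul, map_mul, GradedRing.projZeroRingHom_apply,
    DirectSum.decompose_of_mem_ne 𝒞 ha hn, zero_mul]

end Irrelevant

/-! ### Degrees in a linear resolution -/

namespace LinearResolution

variable {A : Type u} [Ring A] [Algebra ℂ A] {𝒞 : ℕ → Submodule ℂ A} [GradedAlgebra 𝒞]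
  (R : LinearResolution 𝒞)

attribute [local instance] addCommGroup moduleComplex module isScalarTower projective

/-- The decomposition of a term of a linear resolution into its homogeneous components. -/
abbrev decomposition (i : ℕ) : DirectSum.Decomposition (R.deg i) :=
  (R.isInternal i).chooseDecomposition

attribute [local instance] decomposition

theorem deg_eq_zero_of_lt {i j : ℕ} (hj : j < i) {x : R.P i} (hx : x ∈ R.deg i j) : x = 0 :=
  eq_zero_of_mem_of_lt (R.smul_mem i) (R.generated i) hj hx

theorem smulTensor_deg_bijective (h0 : ∀ a ∈ 𝒞 0, ∃ c : ℂ, algebraMap ℂ A c = a) (i : ℕ) :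
    Function.Bijective (smulTensor A (R.deg i i)) :=
  smulTensor_bijective h0 (R.smul_mem i) (R.generated i)

theorem exists_mem_deg_d_eq {i j : ℕ} {x : R.P (i + 1)} (hx : R.d i x ∈ R.deg i j) :
    ∃ y ∈ R.deg (i + 1) j, R.d i y = R.d i x :=
  exists_mem_map_eq (f := (R.d i).restrictScalars ℂ) (R.d_mem i) hx

/-- A boundary of degree `i` lifts to degree `i` of `P (i + 1)`, which vanishes because that module
is generated in degree `i + 1`. This is what makes the differentials injective on generators. -/
theorem d_eq_zero_of_mem {i : ℕ} {x : R.P (i + 1)} (hx : R.d i x ∈ R.deg i i) : R.d i x = 0 := by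
  obtain ⟨y, hy, hyx⟩ := R.exists_mem_deg_d_eq hx
  rw [← hyx, R.deg_eq_zero_of_lt (Nat.lt_succ_self i) hy, map_zero]

end LinearResolution

/-! ### Transport of linear resolutions along a Zhang twist -/

namespace ZhangTwist

variable {Γ : Type v} [AddMonoid Γ] {A B : Type u} [Ring A] [Algebra ℂ A] [Ring B] [Algebra ℂ B]
  {𝒜 : Γ → Submodule ℂ A} {ℬ : Γ → Submodule ℂ B} (Z : ZhangTwist 𝒜 ℬ) (h : Γ →+ ℕ)

theorem equiv_mem_coarsen_iff (n : ℕ) (a : A) :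
    Z.equiv a ∈ coarsen ℬ h n ↔ a ∈ coarsen 𝒜 h n := by
  have hmap : ∀ γ, (𝒜 γ).map Z.equiv.toLinearMap = ℬ γ := fun γ => by
    ext b
    obtain ⟨a, rfl⟩ := Z.equiv.surjective b
    rw [Z.equiv_mem_iff]
    exact (Submodule.mem_map_equiv _).trans (by simp)
  have : (coarsen 𝒜 h n).map Z.equiv.toLinearMap = coarsen ℬ h n := by
    simp only [coarsen, Submodule.map_iSup, hmap]
  rw [← this]
  exact (Submodule.mem_map_equiv _).trans (by simp)

variable [DecidableEq Γ] [GradedAlgebra 𝒜]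

/-- The trivial twisting system on the trivial module of a connected algebra. -/
def ModuleTwist.trivial (h0 : ∀ a ∈ coarsen 𝒜 h 0, ∃ c : ℂ, algebraMap ℂ A c = a) :
    Z.ModuleTwist (A ⧸ (HomogeneousIdeal.irrelevant (coarsen 𝒜 h)).toIdeal) where
  tw _ := LinearEquiv.refl ℂ _
  tw_smul γ δ a m ha := by
    have ha' := le_coarsen 𝒜 h δ ha
    have hta := le_coarsen 𝒜 h δ (Z.tw_mem γ δ a ha)
    simp only [LinearEquiv.refl_apply]
    -- Elements of degree zero are scalars, which the twisting system fixes; those of positive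
    -- degree act by zero.
    by_cases hδ : h δ = 0
    · rw [hδ] at ha'
      obtain ⟨c, rfl⟩ := h0 a ha'
      rw [Algebra.algebraMap_eq_smul_one, map_smul, Z.tw_one]
    · rw [smul_quotient_irrelevant_eq_zero hδ ha', smul_quotient_irrelevant_eq_zero hδ hta]

open LinearResolution

attribute [local instance] addCommGroup moduleComplex module isScalarTower projective decomposition

variable (R : LinearResolution (coarsen 𝒜 h))

theorem ModuleTwist.exists_lift_of_resolution
    (h0 : ∀ a ∈ coarsen 𝒜 h 0, ∃ c : ℂ, algebraMap ℂ A c = a)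
    (i : ℕ) {M : Type*} [AddCommGroup M] [Module ℂ M]
    [Module A M] [IsScalarTower ℂ A M] (d : R.P i →ₗ[A] M) (θ : Z.ModuleTwist M)
    (hd : ∀ v ∈ R.deg i i, d v = 0 → v = 0)
    (hθ : ∀ γ m, (∃ v ∈ R.deg i i, d v = θ.tw γ m) ↔ ∃ v ∈ R.deg i i, d v = m) :
    ∃ θ' : Z.ModuleTwist (R.P i), (∀ γ x, d (θ'.tw γ x) = θ.tw γ (d x)) ∧
      ∀ γ j x, θ'.tw γ x ∈ R.deg i j ↔ x ∈ R.deg i j := by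
  obtain ⟨θ', hθd, hθ'⟩ :=
    ModuleTwist.exists_lift (R.smulTensor_deg_bijective h0 i) d θ hd hθ
  refine ⟨θ', hθd, fun γ j x => ?_⟩
  refine map_mem_iff_of_injective (f := (θ'.tw γ).toLinearMap) (fun j x hx => ?_)
    (θ'.tw γ).injective
  -- A product `a • v` with `a` of degree `δ` and `v` a generator has degree `h δ + i`, and the lift
  -- sends it to a product of the same shape.
  have key : ∀ x, gradedProj (R.deg i) j (θ'.tw γ x) = θ'.tw γ (gradedProj (R.deg i) j x) := by
    intro x
    induction x using span_homogeneous_induction 𝒜 (R.generated i) with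
    | zero => simp
    | add x y hx hy => simp only [map_add, hx, hy]
    | smul δ a ha v hv =>
      obtain ⟨a', ha', v', hv', hav⟩ := hθ' γ δ a ha v hv
      have h1 := R.smul_mem i _ _ _ _ (le_coarsen 𝒜 h δ ha) hv
      have h2 := R.smul_mem i _ _ _ _ (le_coarsen 𝒜 h δ ha') hv'
      rw [← hav] at h2
      by_cases hj : h δ + i = j
      · subst hj
        rw [gradedProj_of_mem h1, gradedProj_of_mem h2]
      · rw [gradedProj_of_mem_ne h1 hj, gradedProj_of_mem_ne h2 hj, map_zero]
  rw [LinearEquiv.coe_coe, ← gradedProj_of_mem hx, ← key]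
  exact gradedProj_mem _ _ _

/-- A twisting system preserves the grading and the boundaries of a term of a linear
resolution. -/
def ModuleTwist.IsGraded {Z : ZhangTwist 𝒜 ℬ} {h : Γ →+ ℕ} {R : LinearResolution (coarsen 𝒜 h)}
    {i : ℕ} (θ : Z.ModuleTwist (R.P i)) : Prop :=
  (∀ γ j x, θ.tw γ x ∈ R.deg i j ↔ x ∈ R.deg i j) ∧
    ∀ γ x, θ.tw γ x ∈ LinearMap.range (R.d i) ↔ x ∈ LinearMap.range (R.d i)

theorem ModuleTwist.exists_isGraded_zero
    (h0 : ∀ a ∈ coarsen 𝒜 h 0, ∃ c : ℂ, algebraMap ℂ A c = a) :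
    ∃ θ : Z.ModuleTwist (R.P 0), θ.IsGraded ∧
    ∀ γ x, R.ε (θ.tw γ x) = R.ε x := by
  obtain ⟨θ, hθ, hθ'⟩ := ModuleTwist.exists_lift_of_resolution Z h R h0 0 R.ε
    (ModuleTwist.trivial Z h h0) (fun v hv hv0 => by
      obtain ⟨z, rfl⟩ := (R.exact_ε v).1 hv0
      exact R.d_eq_zero_of_mem hv) (fun γ m => Iff.rfl)
  refine ⟨θ, ⟨hθ', fun γ x => ?_⟩, hθ⟩
  have hr : ∀ y, y ∈ LinearMap.range (R.d 0) ↔ R.ε y = 0 := fun y => (R.exact_ε y).symm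
  rw [hr, hr, hθ]
  rfl

/-- The generators map onto the boundaries of degree `i + 1` in `P i`, a subspace that `θ` preserves
since it preserves both boundaries and degrees. By exactness the boundaries in `P (i + 1)` form the
kernel of `d i`, which the lift preserves because it commutes with `d i`. -/
theorem ModuleTwist.exists_isGraded_succ
    (h0 : ∀ a ∈ coarsen 𝒜 h 0, ∃ c : ℂ, algebraMap ℂ A c = a)
    (i : ℕ) (θ : Z.ModuleTwist (R.P i)) (hθ : θ.IsGraded) :
    ∃ θ' : Z.ModuleTwist (R.P (i + 1)), θ'.IsGraded ∧
      ∀ γ x, R.d i (θ'.tw γ x) = θ.tw γ (R.d i x) := by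
  have hmap : ∀ m, (∃ v ∈ R.deg (i + 1) (i + 1), R.d i v = m) ↔
      m ∈ LinearMap.range (R.d i) ∧ m ∈ R.deg i (i + 1) := by
    intro m
    constructor
    · rintro ⟨v, hv, rfl⟩
      exact ⟨⟨v, rfl⟩, R.d_mem _ _ _ hv⟩
    · rintro ⟨⟨x, rfl⟩, hx⟩
      exact R.exists_mem_deg_d_eq hx
  obtain ⟨θ', hd, hdeg⟩ := ModuleTwist.exists_lift_of_resolution Z h R h0 (i + 1) (R.d i) θ
    (fun v hv hv0 => by
      obtain ⟨z, rfl⟩ := (R.exact_d i v).1 hv0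
      exact R.d_eq_zero_of_mem hv)
    (fun γ m => by rw [hmap, hmap, hθ.1, hθ.2])
  refine ⟨θ', ⟨hdeg, fun γ x => ?_⟩, hd⟩
  have hr : ∀ y, y ∈ LinearMap.range (R.d (i + 1)) ↔ R.d i y = 0 :=
    fun y => (R.exact_d i y).symm
  rw [hr, hr, hd, LinearEquiv.map_eq_zero_iff]

/-- A linear resolution over a connected algebra carries a twisting system compatible with the
differentials and the augmentation. -/
theorem ModuleTwist.exists_resolution
    (h0 : ∀ a ∈ coarsen 𝒜 h 0, ∃ c : ℂ, algebraMap ℂ A c = a) :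
    ∃ θ : ∀ i, Z.ModuleTwist (R.P i),
    (∀ i, (θ i).IsGraded) ∧ (∀ i γ x, R.d i ((θ (i + 1)).tw γ x) = (θ i).tw γ (R.d i x)) ∧
      ∀ γ x, R.ε ((θ 0).tw γ x) = R.ε x := by
  obtain ⟨θ0, hθ0, hε⟩ := ModuleTwist.exists_isGraded_zero Z h R h0
  choose next hnext hd using ModuleTwist.exists_isGraded_succ Z h R h0
  let θ : ∀ i, {θ : Z.ModuleTwist (R.P i) // θ.IsGraded} := fun i =>
    Nat.rec ⟨θ0, hθ0⟩ (fun i θ => ⟨next i θ.1 θ.2, hnext i θ.1 θ.2⟩) i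
  exact ⟨fun i => (θ i).1, fun i => (θ i).2, fun i => hd i (θ i).1 (θ i).2, hε⟩

variable [GradedAlgebra ℬ]

theorem equiv_mem_irrelevant_iff (a : A) :
    Z.equiv a ∈ (HomogeneousIdeal.irrelevant (coarsen ℬ h)).toIdeal ↔
      a ∈ (HomogeneousIdeal.irrelevant (coarsen 𝒜 h)).toIdeal := by
  have := gradedProj_map (f := Z.equiv.toLinearMap) (D := coarsen 𝒜 h) (E := coarsen ℬ h)
    (fun n a ha => (Z.equiv_mem_coarsen_iff h n a).2 ha) 0 a
  rw [mem_irrelevant_iff_projZero, mem_irrelevant_iff_projZero]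
  change gradedProj (coarsen ℬ h) 0 (Z.equiv.toLinearMap a) = 0 ↔ gradedProj (coarsen 𝒜 h) 0 a = 0
  rw [this]
  simp

/-- The identification of the quotients of `A` and `B` by their irrelevant ideals. -/
def quotientEquiv : (A ⧸ (HomogeneousIdeal.irrelevant (coarsen 𝒜 h)).toIdeal) ≃ₗ[ℂ]
    B ⧸ (HomogeneousIdeal.irrelevant (coarsen ℬ h)).toIdeal :=
  (Submodule.Quotient.restrictScalarsEquiv ℂ _).symm ≪≫ₗ
    Submodule.Quotient.equiv _ _ Z.equiv (by
      ext b
      obtain ⟨a, rfl⟩ := Z.equiv.surjective b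
      refine (Submodule.mem_map_equiv _).trans ?_
      simp only [LinearEquiv.symm_apply_apply, Submodule.restrictScalars_mem]
      exact (Z.equiv_mem_irrelevant_iff h a).symm) ≪≫ₗ
    Submodule.Quotient.restrictScalarsEquiv ℂ _

/-- No twist appears on the right because the system on the trivial module is the identity. -/
theorem quotientEquiv_smul
    (h0 : ∀ a ∈ coarsen 𝒜 h 0, ∃ c : ℂ, algebraMap ℂ A c = a)
    {γ : Γ} {a : A} (ha : a ∈ 𝒜 γ)
    (m : A ⧸ (HomogeneousIdeal.irrelevant (coarsen 𝒜 h)).toIdeal) :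
    Z.quotientEquiv h (a • m) = Z.equiv a • Z.quotientEquiv h m := by
  have ha' := le_coarsen 𝒜 h γ ha
  by_cases hγ : h γ = 0
  · rw [hγ] at ha'
    obtain ⟨c, rfl⟩ := h0 a ha'
    rw [algebraMap_smul, map_smul, Algebra.algebraMap_eq_smul_one, map_smul, Z.equiv_one,
      smul_assoc, one_smul]
  · rw [smul_quotient_irrelevant_eq_zero hγ ha', map_zero,
      smul_quotient_irrelevant_eq_zero hγ ((Z.equiv_mem_coarsen_iff h _ a).2 ha')]

theorem nonempty_linearResolution (Z : ZhangTwist 𝒜 ℬ)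
    (h0 : ∀ a ∈ coarsen 𝒜 h 0, ∃ c : ℂ, algebraMap ℂ A c = a)
    (R : LinearResolution (coarsen 𝒜 h)) :
    Nonempty (LinearResolution (coarsen ℬ h)) := by
  obtain ⟨θ, hθ, hd, hε⟩ := ModuleTwist.exists_resolution Z h R h0
  have hsmul : ∀ (i m n : ℕ) (b : B) (x : R.P i), b ∈ coarsen ℬ h m → x ∈ R.deg i n →
      (θ i).act b x ∈ R.deg i (m + n) := by
    intro i m n b x hb hx
    refine Submodule.iSup_induction _
      (motive := fun b => (θ i).act b x ∈ R.deg i (m + n)) hb ?_ (by simp)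
      (fun a b ha hb => by rw [map_add, LinearMap.add_apply]; exact add_mem ha hb)
    rintro ⟨γ, rfl⟩ b hb
    obtain ⟨a, rfl⟩ := Z.equiv.surjective b
    have ha := (Z.equiv_mem_iff _ _).1 hb
    rw [(θ i).act_equiv ha]
    exact R.smul_mem _ _ _ _ _ (le_coarsen 𝒜 h γ ha) (((hθ i).1 _ _ _).2 hx)
  have hgen : ∀ i, letI := (θ i).module
      Submodule.span B (R.deg i i : Set (R.P i)) = ⊤ := by
    intro i
    let := (θ i).module
    rw [Submodule.eq_top_iff']
    intro x
    induction x using span_homogeneous_induction 𝒜 (R.generated i) with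
    | zero => exact zero_mem _
    | add x y hx hy => exact add_mem hx hy
    | smul γ a ha v hv =>
      -- Untwisting moves `v` to `θ_γ⁻¹(v)`, which is again a generator of degree `i`.
      have : a • v = Z.equiv a • ((θ i).tw γ).symm v := by
        rw [(θ i).equiv_smul ha, LinearEquiv.apply_symm_apply]
      rw [this]
      exact Submodule.smul_mem _ _ (Submodule.subset_span
        (((hθ i).1 γ i _).1 (by rwa [LinearEquiv.apply_symm_apply])))
  have hdact : ∀ i b x, R.d i ((θ (i + 1)).act b x) = (θ i).act b (R.d i x) := by
    intro i b x
    induction b using Z.equiv_homogeneous_induction with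
    | zero => simp
    | add b c hb hc => simp only [map_add, LinearMap.add_apply, hb, hc]
    | equiv γ a ha =>
      rw [(θ (i + 1)).act_equiv ha, (θ i).act_equiv ha, map_smul, hd]
  have hεact : ∀ b x, Z.quotientEquiv h (R.ε ((θ 0).act b x)) =
      b • Z.quotientEquiv h (R.ε x) := by
    intro b x
    induction b using Z.equiv_homogeneous_induction with
    | zero => rw [map_zero, LinearMap.zero_apply, map_zero, map_zero, zero_smul]
    | add b c hb hc => simp only [map_add, LinearMap.add_apply, hb, hc, add_smul]
    | equiv γ a ha => rw [(θ 0).act_equiv ha, map_smul, hε, Z.quotientEquiv_smul h h0 ha]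
  exact ⟨{
    P := R.P
    addCommGroup := R.addCommGroup
    moduleComplex := R.moduleComplex
    module := fun i => (θ i).module
    isScalarTower := fun i => (θ i).isScalarTower
    deg := R.deg
    isInternal := R.isInternal
    smul_mem := hsmul
    projective := fun i =>
      (θ i).projective (R.smulTensor_deg_bijective h0 i) (fun γ => (hθ i).1 γ i)
    generated := hgen
    d := fun i =>
      letI := (θ i).module
      letI := (θ (i + 1)).module
      { toFun := R.d i
        map_add' := map_add _
        map_smul' := hdact i }
    d_mem := R.d_mem
    ε :=
      letI := (θ 0).module
      { toFun := fun x => Z.quotientEquiv h (R.ε x)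
        map_add' := fun x y => by rw [map_add, map_add]
        map_smul' := hεact }
    ε_eq_zero := fun j x hj hx => by
      change Z.quotientEquiv h (R.ε x) = 0
      rw [R.ε_eq_zero j x hj hx, map_zero]
    exact_d := R.exact_d
    exact_ε := fun x => by
      change Z.quotientEquiv h (R.ε x) = 0 ↔ _
      rw [LinearEquiv.map_eq_zero_iff]
      exact R.exact_ε x
    surjective_ε := (Z.quotientEquiv h).surjective.comp R.surjective_ε }⟩

end ZhangTwist

/-! ### The twisted algebra and the original one as Zhang twists of each other -/

section Twist

variable {Γ : Type v} [AddMonoid Γ] {A : Type u} [Ring A] [Algebra ℂ A]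
  {𝒜 : Γ → Submodule ℂ A} (τ : TwistingFamily 𝒜)

theorem Twist.of_mem_grading_iff (γ : Γ) (a : A) : Twist.of τ a ∈ Twist.grading τ γ ↔ a ∈ 𝒜 γ :=
  (Submodule.mem_map_equiv _).trans (by simp)

variable [DecidableEq Γ] [GradedAlgebra 𝒜]

theorem TwistingFamily.symm_mem (γ δ : Γ) (a : A) (ha : a ∈ 𝒜 δ) : (τ.aut γ).symm a ∈ 𝒜 δ :=
  (map_mem_iff_of_injective (f := (τ.aut γ).toLinearMap) (τ.map_mem γ)
    (τ.aut γ).injective).1 (by simpa using ha)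

/-- The twisted algebra as a Zhang twist of the original one. -/
def TwistingFamily.zhangTwist : ZhangTwist 𝒜 (Twist.grading τ) where
  equiv := Twist.of τ
  equiv_mem_iff := Twist.of_mem_grading_iff τ
  equiv_one := rfl
  tw γ := (τ.aut γ).toLinearEquiv
  tw_mem := τ.map_mem
  tw_one γ := map_one (τ.aut γ)
  tw_mul γ δ a b _ := by simp [τ.map_add]
  equiv_mul γ a b ha := (Twist.of_mul_of τ ha b).symm

/-- The original algebra as a Zhang twist of the twisted one. -/
def TwistingFamily.zhangTwistSymm : ZhangTwist (Twist.grading τ) 𝒜 where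
  equiv := (Twist.of τ).symm
  equiv_mem_iff γ a := by
    obtain ⟨a, rfl⟩ := (Twist.of τ).surjective a
    rw [LinearEquiv.symm_apply_apply, Twist.of_mem_grading_iff]
  equiv_one := rfl
  tw γ := (Twist.of τ).symm ≪≫ₗ (τ.aut γ).symm.toLinearEquiv ≪≫ₗ Twist.of τ
  tw_mem γ δ a ha := by
    obtain ⟨a, rfl⟩ := (Twist.of τ).surjective a
    rw [Twist.of_mem_grading_iff] at ha
    simpa [Twist.of_mem_grading_iff] using τ.symm_mem γ δ a ha
  tw_one γ := congrArg (Twist.of τ) (map_one (τ.aut γ).symm)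
  tw_mul γ δ a b ha := by
    obtain ⟨a, rfl⟩ := (Twist.of τ).surjective a
    obtain ⟨b, rfl⟩ := (Twist.of τ).surjective b
    rw [Twist.of_mem_grading_iff] at ha
    simp only [LinearEquiv.trans_apply, LinearEquiv.symm_apply_apply, AlgEquiv.coe_toLinearEquiv]
    rw [Twist.of_mul_of τ ha, Twist.of_mul_of τ (τ.symm_mem γ δ a ha)]
    congr 1
    -- After applying `τ_γ`, the claim reduces to `τ_γ τ_δ τ_{γ+δ}⁻¹ = 1`, which is
    -- multiplicativity.
    apply (τ.aut γ).injective
    simp only [LinearEquiv.symm_apply_apply, map_mul, AlgEquiv.apply_symm_apply]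
    rw [← AlgEquiv.mul_apply (τ.aut γ), ← τ.map_add, AlgEquiv.apply_symm_apply]
  equiv_mul γ a b ha := by
    obtain ⟨a, rfl⟩ := (Twist.of τ).surjective a
    obtain ⟨b, rfl⟩ := (Twist.of τ).surjective b
    rw [Twist.of_mem_grading_iff] at ha
    simp only [LinearEquiv.trans_apply, LinearEquiv.symm_apply_apply, AlgEquiv.coe_toLinearEquiv]
    rw [Twist.of_mul_of τ ha, LinearEquiv.symm_apply_apply, AlgEquiv.apply_symm_apply]

end Twist

end

theorem propositionA1 {Γ : Type v} [AddMonoid Γ] [DecidableEq Γ]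
    {A : Type u} [Ring A] [Algebra ℂ A] (𝒜 : Γ → Submodule ℂ A) [GradedAlgebra 𝒜]
    (τ : TwistingFamily 𝒜) (h : Γ →+ ℕ)
    (hA : Algebra.adjoin ℂ (coarsen 𝒜 h 1 : Set A) = ⊤)
    (hAτ : Algebra.adjoin ℂ (coarsen (Twist.grading τ) h 1 : Set (Twist τ)) = ⊤) :
    IsKoszul (coarsen (Twist.grading τ) h) ↔ IsKoszul (coarsen 𝒜 h) := by
  have h0 := exists_algebraMap_eq_of_adjoin_eq_top (coarsen 𝒜 h) hA
  have h0τ := exists_algebraMap_eq_of_adjoin_eq_top (coarsen (Twist.grading τ) h) hAτ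
  constructor
  · rintro ⟨-, ⟨R⟩⟩
    exact ⟨isSemisimpleRing_zero _ h0, τ.zhangTwistSymm.nonempty_linearResolution h h0τ R⟩
  · rintro ⟨-, ⟨R⟩⟩
    exact ⟨isSemisimpleRing_zero _ h0τ, τ.zhangTwist.nonempty_linearResolution h h0 R⟩
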